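/- Let $d\ge 1$, $T>0$, let $\Omega\subset\mathbb{R}^d$ be a bounded domain with smooth boundary, and set $Q=\Omega\times(0,T)$, $\Sigma=\partial\Omega\times(0,T)$. Let $H\in C([0,T];\mathbb{R}^d)$. For $g\in L^2(\Sigma)$ consider the (real-valued) problem $$\partial_t u+H(t)\cdot\nabla u=0\ \text{ in } Q,\qquad u=g\ \text{ on }\Sigma, \tag{1}$$ where $u\in H^1(Q)$, the equation holds almost everywhere in $Q$ and the boundary condition holds in the sense of traces. Every solution $u\in H^1(Q)$ of (1) has a representative in $C([0,T];L^2(\Omega))$, and $u(\cdot,t)$ denotes its value at $t\in[0,T]$. Then: 1. (Energy estimate) There exists a constant $C>0$, independent of $g$, $u$ and $t$, such that $$\Big|\|u(\cdot,t)\|_{L^2(\Omega)}^2-\|u(\cdot,0)\|_{L^2(\Omega)}^2\Big|\le C\|g\|_{L^2(\Sigma)}^2$$ for all $t\in[0,T]$, all $g\in L^2(\Sigma)$ and all $u\in H^1(Q)$ satisfying (1). 2. (Extension of the observability inequality) Assume that there exist $\tau\in[0,T]$ and a constant $C_1>0$ such that $$\|u(\cdot,t)\|_{L^2(\Omega)}\le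 C_1\|g\|_{L^2(\Sigma)}$$ for all $t\in[0,\tau]$, all $g\in L^2(\Sigma)$ and all $u\in H^1(Q)$ satisfying (1). Then there exists a constant $C_2>0$ such that $$\|u(\cdot,t)\|_{L^2(\Omega)}\le C_2\|g\|_{L^2(\Sigma)}$$ for all $t\in[0,T]$, all $g\in L^2(\Sigma)$ and all $u\in H^1(Q)$ satisfying (1). -/

import Mathlib

open MeasureTheory Set Filter Topology
open scoped ContDiff ENNReal

namespace Transport

/-- A bounded domain with smooth boundary: a nonempty connected bounded open set which, near each of
its boundary points, is the sublevel set `{ρ < 0}` of a smooth function `ρ` with nonvanishing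
differential (so it lies locally on one side of its boundary). -/
structure IsSmoothBoundedDomain {d : ℕ} (Ω : Set (EuclideanSpace ℝ (Fin d))) : Prop where
  isOpen : IsOpen Ω
  isConnected : IsConnected Ω
  isBounded : Bornology.IsBounded Ω
  smooth_boundary : ∀ x₀ ∈ frontier Ω, ∃ U : Set (EuclideanSpace ℝ (Fin d)),
    ∃ ρ : EuclideanSpace ℝ (Fin d) → ℝ, IsOpen U ∧ x₀ ∈ U ∧ ContDiffOn ℝ ∞ ρ U ∧
      (∀ x ∈ U, fderiv ℝ ρ x ≠ 0) ∧ Ω ∩ U = {x ∈ U | ρ x < 0}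

/-- The space-time cylinder `Q = Ω × (0,T)`. -/
def cylinder {d : ℕ} (Ω : Set (EuclideanSpace ℝ (Fin d))) (T : ℝ) :
    Set (EuclideanSpace ℝ (Fin d) × ℝ) :=
  Ω ×ˢ Ioo 0 T

/-- Lebesgue measure on `Q = Ω × (0,T)`. -/
noncomputable def cylinderMeasure {d : ℕ} (Ω : Set (EuclideanSpace ℝ (Fin d))) (T : ℝ) :
    Measure (EuclideanSpace ℝ (Fin d) × ℝ) :=
  volume.restrict (cylinder Ω T)

/-- The measure `dσ dt` on `Σ = ∂Ω × (0,T)`, where `dσ` is the surface measure of `∂Ω`, i.e. the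
(Euclidean normalised) `(d-1)`-dimensional Hausdorff measure restricted to `∂Ω`. -/
noncomputable def lateralMeasure {d : ℕ} (Ω : Set (EuclideanSpace ℝ (Fin d))) (T : ℝ) :
    Measure (EuclideanSpace ℝ (Fin d) × ℝ) :=
  ((Measure.euclideanHausdorffMeasure (d - 1)).restrict (frontier Ω)).prod
    (volume.restrict (Ioo 0 T))

/-- The classical time derivative `∂ₜφ` of a differentiable function of `(x,t)`. -/
noncomputable def timeDeriv {d : ℕ} (φ : EuclideanSpace ℝ (Fin d) × ℝ → ℝ) :
    EuclideanSpace ℝ (Fin d) × ℝ → ℝ :=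
  fun z => deriv (fun s => φ (z.1, s)) z.2

/-- The classical spatial gradient `∇φ` of a differentiable function of `(x,t)`. -/
noncomputable def spaceGrad {d : ℕ} (φ : EuclideanSpace ℝ (Fin d) × ℝ → ℝ) :
    EuclideanSpace ℝ (Fin d) × ℝ → EuclideanSpace ℝ (Fin d) :=
  fun z => gradient (fun y => φ (y, z.2)) z.1

/-- Test functions on `Q`: smooth functions with compact support contained in `Q`. -/
structure IsTestFunction {d : ℕ} (Ω : Set (EuclideanSpace ℝ (Fin d))) (T : ℝ)
    (φ : EuclideanSpace ℝ (Fin d) × ℝ → ℝ) : Prop where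
  contDiff : ContDiff ℝ ∞ φ
  hasCompactSupport : HasCompactSupport φ
  tsupport_subset : tsupport φ ⊆ cylinder Ω T

/-- `u` belongs to the Sobolev space `H¹(Q)`, with weak time derivative `ut` and weak spatial
gradient `p` (these are determined by `u` almost everywhere in `Q`). -/
structure IsH1With {d : ℕ} (Ω : Set (EuclideanSpace ℝ (Fin d))) (T : ℝ)
    (u ut : EuclideanSpace ℝ (Fin d) × ℝ → ℝ)
    (p : EuclideanSpace ℝ (Fin d) × ℝ → EuclideanSpace ℝ (Fin d)) : Prop where
  memLp : MemLp u 2 (cylinderMeasure Ω T)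
  memLp_time : MemLp ut 2 (cylinderMeasure Ω T)
  memLp_space : MemLp p 2 (cylinderMeasure Ω T)
  weak_time : ∀ φ, IsTestFunction Ω T φ →
    ∫ z, u z * timeDeriv φ z ∂(cylinderMeasure Ω T) = -∫ z, ut z * φ z ∂(cylinderMeasure Ω T)
  weak_space : ∀ φ, IsTestFunction Ω T φ → ∀ i : Fin d,
    ∫ z, u z * (spaceGrad φ z) i ∂(cylinderMeasure Ω T) =
      -∫ z, (p z) i * φ z ∂(cylinderMeasure Ω T)

/-- `g ∈ L²(Σ)` is the trace on `Σ` of the function `u ∈ H¹(Q)` with weak derivatives `ut`, `p`: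
there are functions smooth up to the boundary that converge to `u` in `H¹(Q)` and whose
restrictions to `Σ` converge to `g` in `L²(Σ)`. (This is the graph of the continuous extension
of the restriction map from smooth functions to `H¹(Q)`.) -/
def IsLateralTrace {d : ℕ} (Ω : Set (EuclideanSpace ℝ (Fin d))) (T : ℝ)
    (u ut : EuclideanSpace ℝ (Fin d) × ℝ → ℝ)
    (p : EuclideanSpace ℝ (Fin d) × ℝ → EuclideanSpace ℝ (Fin d))
    (g : Lp ℝ 2 (lateralMeasure Ω T)) : Prop :=
  ∃ φ : ℕ → EuclideanSpace ℝ (Fin d) × ℝ → ℝ,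
    (∀ n, ContDiff ℝ ∞ (φ n)) ∧
    Tendsto (fun n => eLpNorm (fun z => φ n z - u z) 2 (cylinderMeasure Ω T)) atTop (𝓝 0) ∧
    Tendsto (fun n => eLpNorm (fun z => timeDeriv (φ n) z - ut z) 2 (cylinderMeasure Ω T))
      atTop (𝓝 0) ∧
    Tendsto (fun n => eLpNorm (fun z => spaceGrad (φ n) z - p z) 2 (cylinderMeasure Ω T))
      atTop (𝓝 0) ∧
    Tendsto (fun n => eLpNorm (fun z => φ n z - g z) 2 (lateralMeasure Ω T)) atTop (𝓝 0)

/-- `u ∈ H¹(Q)` solves `∂ₜu + H(t) · ∇u = 0` in `Q`, `u = g` on `Σ`. -/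
def IsSolution {d : ℕ} (Ω : Set (EuclideanSpace ℝ (Fin d))) (T : ℝ)
    (H : ℝ → EuclideanSpace ℝ (Fin d)) (g : Lp ℝ 2 (lateralMeasure Ω T))
    (u : EuclideanSpace ℝ (Fin d) × ℝ → ℝ) : Prop :=
  ∃ (ut : EuclideanSpace ℝ (Fin d) × ℝ → ℝ)
    (p : EuclideanSpace ℝ (Fin d) × ℝ → EuclideanSpace ℝ (Fin d)),
    IsH1With Ω T u ut p ∧
    (∀ᵐ z ∂(cylinderMeasure Ω T), ut z + inner ℝ (H z.2) (p z) = 0) ∧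
    IsLateralTrace Ω T u ut p g

/-- `v` is the representative of `u` in `C([0,T]; L²(Ω))`; thus `v t` is the time slice `u(·,t)`,
for every `t ∈ [0,T]`. -/
def IsTimeSlice {d : ℕ} (Ω : Set (EuclideanSpace ℝ (Fin d))) (T : ℝ)
    (u : EuclideanSpace ℝ (Fin d) × ℝ → ℝ)
    (v : ℝ → Lp ℝ 2 (volume.restrict Ω)) : Prop :=
  ContinuousOn v (Icc 0 T) ∧
  ∀ᵐ t ∂(volume.restrict (Ioo 0 T)), (v t : EuclideanSpace ℝ (Fin d) → ℝ)
    =ᵐ[volume.restrict Ω] fun x => u (x, t)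

/-- The observability inequality `‖u(·,t)‖_{L²(Ω)} ≤ C ‖g‖_{L²(Σ)}` for all `t ∈ [0,τ]`, all
`g ∈ L²(Σ)` and all solutions `u ∈ H¹(Q)` with boundary value `g`. -/
def ObservabilityOn {d : ℕ} (Ω : Set (EuclideanSpace ℝ (Fin d))) (T : ℝ)
    (H : ℝ → EuclideanSpace ℝ (Fin d)) (τ C : ℝ) : Prop :=
  ∀ (g : Lp ℝ 2 (lateralMeasure Ω T)) (u : EuclideanSpace ℝ (Fin d) × ℝ → ℝ)
    (v : ℝ → Lp ℝ 2 (volume.restrict Ω)),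
    IsSolution Ω T H g u → IsTimeSlice Ω T u v → ∀ t ∈ Icc 0 τ, ‖v t‖ ≤ C * ‖g‖

end Transport

/-! Multiplying the equation by `2u` gives formally `∂ₜ(u²) + div(u² H) = 0`, because `H` does not
depend on `x`. Integrated over `Ω × (0,t)`, this says that the energy changes only through the
lateral boundary, where `u² = g²`; the change is therefore at most a constant, depending on the
dimension and on `max |H|`, times `‖g‖²`. A bound on `u(·,0)` then propagates to all times.

The flux needs no normal vector, only the estimate `|∫_Ω ∂ᵢf| ≤ 2 ∫_∂Ω |f| dσ`
(`enorm_setIntegral_partialDeriv_le`). By Fubini it reduces to lines parallel to an axis: such a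
line meets `Ω` in disjoint intervals with endpoints in `∂Ω`, so the integral along it is controlled
by the values of `f` at its boundary points (`enorm_setIntegral_deriv_le_tsum_frontier`).
Integrating these sums over all lines costs at most the surface integral, since the projection along
an axis is 1-Lipschitz; this is Eilenberg's inequality (`lintegral_tsum_fiber_le`).

For `u ∈ H¹(Q)`, the estimate is proved for smooth `φ`, with the residual `∂ₜφ + H·∇φ` as an error
term (`enorm_energy_sub_le`), and applied to the approximations that define the trace. Their
residuals tend to `0` in `L²(Q)`, and their time slices converge uniformly in `t`
(`exists_isTimeSlice`), because the `L²(Ω)` norm of each slice is bounded by the `L²(Q)` norms of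
`φ` and `∂ₜφ` (`eLpNorm_slice_sq_le`). -/

namespace Transport

/-! ### Open subsets of the line and their endpoints -/

/-- A bounded open subset of the line is a countable disjoint union of open intervals whose
endpoints belong to its frontier; the intervals are indexed by their left endpoints. -/
theorem exists_interval_decomposition {U : Set ℝ} (hU : IsOpen U) (hb : Bornology.IsBounded U) :
    ∃ (L : Set ℝ) (b : ℝ → ℝ), L.Countable ∧ L ⊆ frontier U ∧ (∀ a ∈ L, a < b a) ∧
      (∀ a ∈ L, b a ∈ frontier U) ∧ InjOn b L ∧ L.PairwiseDisjoint (fun a => Ioo a (b a)) ∧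
      U = ⋃ a ∈ L, Ioo a (b a) := by
  obtain ⟨R, hR⟩ := hb.subset_closedBall 0
  have hR' : ∀ x ∈ U, -R ≤ x ∧ x ≤ R := fun x hx => by
    have := hR hx
    rw [Metric.mem_closedBall, dist_zero_right, Real.norm_eq_abs] at this
    exact abs_le.1 this
  let L : Set ℝ := {a | a ∉ U ∧ ∃ b, a < b ∧ b ∉ U ∧ Ioo a b ⊆ U}
  have hL : ∀ a ∈ L, ∃ b, a < b ∧ b ∉ U ∧ Ioo a b ⊆ U := fun a ha => ha.2
  choose! b hab hbU hsub using hL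
  -- Otherwise `a'`, a point outside `U`, would lie inside `Ioo a (b a) ⊆ U`.
  have key : ∀ a ∈ L, ∀ a' ∈ L, a < a' → b a ≤ a' := fun a ha a' ha' h => by
    by_contra! h'
    exact ha'.1 (hsub a ha ⟨h, h'⟩)
  have hdisj : L.PairwiseDisjoint (fun a => Ioo a (b a)) := by
    intro a ha a' ha' hne
    rcases lt_or_gt_of_ne hne with h | h
    · exact Set.disjoint_left.2 fun x hx hx' => by
        have := key a ha a' ha' h
        linarith [hx.2, hx'.1]
    · exact Set.disjoint_left.2 fun x hx hx' => by
        have := key a' ha' a ha h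
        linarith [hx'.2, hx.1]
  refine ⟨L, b, ?_, ?_, hab, ?_, ?_, hdisj, ?_⟩
  · exact hdisj.countable_of_isOpen (fun a _ => isOpen_Ioo) fun a ha => nonempty_Ioo.2 (hab a ha)
  · intro a ha
    rw [hU.frontier_eq]
    refine ⟨closure_mono (hsub a ha) ?_, ha.1⟩
    rw [closure_Ioo (hab a ha).ne]
    exact left_mem_Icc.2 (hab a ha).le
  · intro a ha
    rw [hU.frontier_eq]
    refine ⟨closure_mono (hsub a ha) ?_, hbU a ha⟩
    rw [closure_Ioo (hab a ha).ne]
    exact right_mem_Icc.2 (hab a ha).le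
  · intro a ha a' ha' h
    by_contra hne
    rcases lt_or_gt_of_ne hne with h' | h'
    · linarith [key a ha a' ha' h', hab a' ha']
    · linarith [key a' ha' a ha h', hab a ha]
  · refine Subset.antisymm (fun x hx => ?_) (iUnion₂_subset hsub)
    have hcl : IsClosed Uᶜ := hU.isClosed_compl
    let A := Uᶜ ∩ Iic x
    let B := Uᶜ ∩ Ici x
    have hA : A.Nonempty := ⟨min x (-R - 1), fun h => by
      linarith [(hR' _ h).1, min_le_right x (-R - 1)], mem_Iic.2 (min_le_left _ _)⟩
    have hB : B.Nonempty := ⟨max x (R + 1), fun h => by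
      linarith [(hR' _ h).2, le_max_right x (R + 1)], mem_Ici.2 (le_max_left _ _)⟩
    have hAb : BddAbove A := ⟨x, fun y hy => hy.2⟩
    have hBb : BddBelow B := ⟨x, fun y hy => hy.2⟩
    have ha := (hcl.inter isClosed_Iic).csSup_mem hA hAb
    have hb := (hcl.inter isClosed_Ici).csInf_mem hB hBb
    have hax : sSup A < x := lt_of_le_of_ne ha.2 fun h => ha.1 (by rwa [h])
    have hbx : x < sInf B := lt_of_le_of_ne hb.2 fun h => hb.1 (by rwa [← h])
    have hin : Ioo (sSup A) (sInf B) ⊆ U := fun y hy => by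
      by_contra hyU
      rcases le_total y x with h | h
      · exact absurd (le_csSup hAb ⟨hyU, h⟩) (not_le.2 hy.1)
      · exact absurd (csInf_le hBb ⟨hyU, h⟩) (not_le.2 hy.2)
    have haL : sSup A ∈ L := ⟨ha.1, sInf B, hax.trans hbx, hb.1, hin⟩
    refine mem_iUnion₂.2 ⟨_, haL, hax, ?_⟩
    -- The right endpoint chosen for `sSup A` is only known to avoid `U`; were it at most `x`, it
    -- would lie in `(sSup A, x] ⊆ U`.
    by_contra! h
    rcases h.eq_or_lt with h | h
    · exact hbU _ haL (h ▸ hx)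
    · exact hbU _ haL (hin ⟨hab _ haL, h.trans hbx⟩)

/-- The integral of a derivative over a bounded open subset of the line is controlled by the values
of the function on the frontier. -/
theorem enorm_setIntegral_deriv_le_tsum_frontier {U : Set ℝ} (hU : IsOpen U)
    (hb : Bornology.IsBounded U) {f f' : ℝ → ℝ} (hf : ∀ x, HasDerivAt f (f' x) x)
    (hf' : Continuous f') :
    ‖∫ x in U, f' x‖ₑ ≤ 2 * ∑' x : frontier U, ‖f x‖ₑ := by
  obtain ⟨L, b, hc, hLU, hab, hbU, hinj, hdisj, hUeq⟩ := exists_interval_decomposition hU hb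
  have : Countable L := hc
  have hint : IntegrableOn f' U :=
    (hf'.continuousOn.integrableOn_compact hb.isCompact_closure).mono_set subset_closure
  have hUeq' : U = ⋃ a : L, Ioo (a : ℝ) (b a) := by rw [iUnion_coe_set]; exact hUeq
  have hsum : HasSum (fun a : L => ∫ x in Ioo (a : ℝ) (b a), f' x) (∫ x in U, f' x) := by
    rw [hUeq']
    refine hasSum_integral_iUnion (fun _ => measurableSet_Ioo) (fun a a' h => ?_) (hUeq' ▸ hint)
    exact hdisj a.2 a'.2 (Subtype.coe_injective.ne h)
  have hI : ∀ a : L, ∫ x in Ioo (a : ℝ) (b a), f' x = f (b a) - f a := fun a => by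
    rw [← integral_Ioc_eq_integral_Ioo, ← intervalIntegral.integral_of_le (hab a a.2).le]
    exact intervalIntegral.integral_eq_sub_of_hasDerivAt (fun x _ => hf x)
      (hf'.intervalIntegrable _ _)
  simp_rw [hI] at hsum
  calc ‖∫ x in U, f' x‖ₑ ≤ ∑' a : L, ‖f (b a) - f a‖ₑ := by
        rw [← hsum.tsum_eq]; exact enorm_tsum_le_tsum_enorm
    _ ≤ ∑' a : L, (‖f (b a)‖ₑ + ‖f a‖ₑ) := ENNReal.tsum_le_tsum fun a => enorm_sub_le
    _ = ∑' a : L, ‖f (b a)‖ₑ + ∑' a : L, ‖f a‖ₑ := ENNReal.tsum_add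
    _ ≤ 2 * ∑' x : frontier U, ‖f x‖ₑ := by
      rw [two_mul]
      -- A frontier point is the left endpoint of at most one interval and the right endpoint of at
      -- most one, whence the factor 2.
      refine add_le_add ?_ ?_
      · exact ENNReal.tsum_comp_le_tsum_of_injective
          (f := fun a : L => (⟨b a, hbU a a.2⟩ : frontier U))
          (fun a a' h => Subtype.ext (hinj a.2 a'.2 (Subtype.ext_iff.1 h)))
          (fun x : frontier U => ‖f x‖ₑ)
      · exact ENNReal.tsum_comp_le_tsum_of_injective
          (f := fun a : L => (⟨a, hLU a.2⟩ : frontier U))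
          (fun a a' h => by simpa [Subtype.ext_iff] using h)
          (fun x : frontier U => ‖f x‖ₑ)

/-! ### Eilenberg's inequality -/

/-- A separable metric space splits into countably many measurable pieces contained in balls of a
given radius. -/
theorem exists_measurable_partition_subset_ball {X : Type*} [PseudoMetricSpace X]
    [SecondCountableTopology X] [Nonempty X] [MeasurableSpace X] [OpensMeasurableSpace X] {r : ℝ}
    (hr : 0 < r) :
    ∃ (A : ℕ → Set X) (c : ℕ → X), (∀ j, MeasurableSet (A j)) ∧ Pairwise (Function.onFun Disjoint A) ∧
      ⋃ j, A j = univ ∧ ∀ j, A j ⊆ Metric.ball (c j) r := by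
  refine ⟨disjointed fun j => Metric.ball (TopologicalSpace.denseSeq X j) r,
    TopologicalSpace.denseSeq X, fun j => ?_, disjoint_disjointed _, ?_,
    fun j => disjointed_subset _ j⟩
  · exact MeasurableSet.disjointed (fun _ => measurableSet_ball) j
  · rw [iUnion_disjointed]
    refine eq_univ_of_forall fun x => ?_
    obtain ⟨j, hj⟩ := (TopologicalSpace.denseRange_denseSeq X).exists_dist_lt x hr
    exact mem_iUnion.2 ⟨j, hj⟩

/-- Eilenberg's inequality for maps that do not increase the measure: the integral of the sums over
the fibres is at most the integral upstairs. -/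
theorem lintegral_tsum_fiber_le {X Y : Type*} [MetricSpace X]
    [SecondCountableTopology X] [MeasurableSpace X] [OpensMeasurableSpace X]
    [MeasurableSpace Y] {μ : Measure X} {ν : Measure Y} {π : X → Y}
    (hπ : ∀ A, ν (π '' A) ≤ μ A) {K : Set X} (hK : MeasurableSet K) {f : X → ℝ≥0∞}
    (hf : Continuous f) :
    ∫⁻ y, ∑' x : ↥(K ∩ π ⁻¹' {y}), f x ∂ν ≤ ∫⁻ x in K, f x ∂μ := by
  rcases isEmpty_or_nonempty X with hX | hX
  · simp
  have hr : ∀ n : ℕ, (0 : ℝ) < 1 / (n + 1) := fun n => Nat.one_div_pos_of_nat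
  choose A c hAm hAd hAu hAb using fun n =>
    exists_measurable_partition_subset_ball (X := X) (hr n)
  -- An empty piece has `m n j = ⊤`, which is harmless: its image is null and `⊤ * 0 = 0`.
  let m : ℕ → ℕ → ℝ≥0∞ := fun n j => ⨅ x ∈ K ∩ A n j, f x
  -- Images of measurable sets need not be measurable, so they are replaced by measurable hulls of
  -- the same measure.
  let S : ℕ → ℕ → Set Y := fun n j => toMeasurable ν (π '' (K ∩ A n j))
  let g : ℕ → Y → ℝ≥0∞ := fun n y => ∑' j, (S n j).indicator (fun _ => m n j) y
  have hg : ∀ n, Measurable (g n) := fun n => Measurable.tsum fun j =>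
    measurable_const.indicator (measurableSet_toMeasurable _ _)
  have hgint : ∀ n, ∫⁻ y, g n y ∂ν ≤ ∫⁻ x in K, f x ∂μ := fun n => by
    calc ∫⁻ y, g n y ∂ν = ∑' j, m n j * ν (S n j) := by
          rw [lintegral_tsum fun j =>
            (measurable_const.indicator (measurableSet_toMeasurable _ _)).aemeasurable]
          exact tsum_congr fun j => lintegral_indicator_const (measurableSet_toMeasurable _ _) _
      _ ≤ ∑' j, ∫⁻ x in K ∩ A n j, f x ∂μ := ENNReal.tsum_le_tsum fun j => by
          rw [measure_toMeasurable]
          calc m n j * ν (π '' (K ∩ A n j)) ≤ m n j * μ (K ∩ A n j) := by gcongr; exact hπ _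
            _ = ∫⁻ _ in K ∩ A n j, m n j ∂μ := (setLIntegral_const _ _).symm
            _ ≤ _ := setLIntegral_mono' (hK.inter (hAm n j)) fun x hx => iInf₂_le x hx
      _ = ∫⁻ x in K, f x ∂μ := by
          rw [← lintegral_iUnion (fun j => hK.inter (hAm n j)) fun i j h =>
            (hAd n h).mono inter_subset_right inter_subset_right, ← inter_iUnion, hAu, inter_univ]
  -- Fatou's lemma: it suffices to bound the fibre sum pointwise by the liminf of the `g n`, so its
  -- own measurability never enters.
  refine le_trans (lintegral_mono fun y => ?_) ((lintegral_liminf_le (u := atTop) hg).trans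
    (liminf_le_of_frequently_le' (Frequently.of_forall hgint)))
  choose j hj using fun n x => mem_iUnion.1 ((hAu n).symm ▸ mem_univ x : x ∈ ⋃ j, A n j)
  have hdist : ∀ n x x', x' ∈ A n (j n x) → dist x' x < 2 * (1 / ((n : ℝ) + 1)) := by
    intro n x x' h
    have h1 := Metric.mem_ball.1 (hAb n _ h)
    have h2 := Metric.mem_ball.1 (hAb n _ (hj n x))
    linarith [dist_triangle_right x' x (c n (j n x))]
  have hlim : Tendsto (fun n : ℕ => 2 * (1 / ((n : ℝ) + 1))) atTop (𝓝 0) := by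
    simpa using (tendsto_one_div_add_atTop_nhds_zero_nat (𝕜 := ℝ)).const_mul 2
  have hm : ∀ x ∈ K, Tendsto (fun n => m n (j n x)) atTop (𝓝 (f x)) := by
    intro x hx
    refine tendsto_order.2 ⟨fun a ha => ?_, fun a ha => Eventually.of_forall fun n =>
      (iInf₂_le x ⟨hx, hj n x⟩).trans_lt ha⟩
    obtain ⟨b, hab, hb⟩ := exists_between ha
    obtain ⟨ε, hε, hball⟩ := Metric.eventually_nhds_iff.1
      (hf.continuousAt.eventually (lt_mem_nhds hb) : ∀ᶠ z in 𝓝 x, b < f z)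
    filter_upwards [hlim.eventually (gt_mem_nhds hε)] with n hn
    exact hab.trans_le (le_iInf₂ fun z hz => (hball ((hdist n x z hz.2).trans hn)).le)
  rw [ENNReal.tsum_eq_iSup_sum]
  refine iSup_le fun s => ?_
  have hs : Tendsto (fun n => ∑ x ∈ s, m n (j n x)) atTop (𝓝 (∑ x ∈ s, f x)) :=
    tendsto_finsetSum _ fun x _ => hm x x.2.1
  rw [← hs.liminf_eq]
  refine liminf_le_liminf ?_
  -- Once the pieces are small enough, finitely many points of the fibre lie in different pieces,
  -- and each accounts for its own term of `g n y`.
  have hinj : ∀ᶠ n in atTop, ∀ x ∈ s, ∀ x' ∈ s, j n x = j n x' → x = x' := by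
    simp_rw [Filter.eventually_all_finset]
    intro x _ x' _
    by_cases hxx : x = x'
    · exact Eventually.of_forall fun _ _ => hxx
    · have : 0 < dist (x : X) x' := dist_pos.2 (Subtype.coe_injective.ne hxx)
      filter_upwards [hlim.eventually (gt_mem_nhds this)] with n hn h
      exact absurd (hdist n x' x (h ▸ hj n x)) (not_lt.2 hn.le)
  filter_upwards [hinj] with n hn
  calc ∑ x ∈ s, m n (j n x)
      = ∑ k ∈ s.image (fun x : ↥(K ∩ π ⁻¹' {y}) => j n x), (S n k).indicator (fun _ => m n k) y := by
        rw [Finset.sum_image fun x hx x' hx' h => hn x hx x' hx' h]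
        refine Finset.sum_congr rfl fun x _ => ?_
        have hx : y ∈ S n (j n x) := subset_toMeasurable _ _ ⟨x, ⟨x.2.1, hj n x⟩, x.2.2⟩
        simp only [indicator_of_mem hx]
    _ ≤ g n y := ENNReal.sum_le_tsum _

/-! ### Boundary estimate along coordinate lines -/

/-- The projection of `ℝⁿ⁺¹` along the `i`-th coordinate axis. -/
def dropCoord {n : ℕ} (i : Fin (n + 1)) (x : EuclideanSpace ℝ (Fin (n + 1))) : Fin n → ℝ :=
  fun j => x (i.succAbove j)

/-- The line over `y` in the direction of the `i`-th coordinate axis. -/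
def coordLine {n : ℕ} (i : Fin (n + 1)) (y : Fin n → ℝ) (r : ℝ) : EuclideanSpace ℝ (Fin (n + 1)) :=
  WithLp.toLp 2 (i.insertNth r y)

theorem coordLine_apply_self {n : ℕ} (i : Fin (n + 1)) (y : Fin n → ℝ) (r : ℝ) :
    coordLine i y r i = r := by
  simp [coordLine]

theorem dropCoord_coordLine {n : ℕ} (i : Fin (n + 1)) (y : Fin n → ℝ) (r : ℝ) :
    dropCoord i (coordLine i y r) = y := by
  ext j; simp [coordLine, dropCoord]

theorem coordLine_add {n : ℕ} (i : Fin (n + 1)) (y : Fin n → ℝ) (r s : ℝ) :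
    coordLine i y (r + s) = coordLine i y r + s • EuclideanSpace.single i (1 : ℝ) := by
  ext j
  refine Fin.succAboveCases i ?_ (fun k => ?_) j <;> simp [coordLine]

theorem continuous_coordLine {n : ℕ} (i : Fin (n + 1)) (y : Fin n → ℝ) :
    Continuous (coordLine i y) := by
  have : coordLine i y = fun s => coordLine i y 0 + s • EuclideanSpace.single i (1 : ℝ) := by
    ext1 s; rw [← coordLine_add, zero_add]
  rw [this]; fun_prop

/-- Forgetting a coordinate is 1-Lipschitz for the Euclidean norms, so it does not increase
Hausdorff measure, and the normalised measure on `ℝⁿ` is Lebesgue measure. No measurability of `A`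
is required, as Eilenberg's inequality demands. -/
theorem volume_dropCoord_image_le {n : ℕ} (i : Fin (n + 1))
    (A : Set (EuclideanSpace ℝ (Fin (n + 1)))) :
    volume (dropCoord i '' A) ≤ Measure.euclideanHausdorffMeasure n A := by
  have hL : LipschitzWith 1 (fun x : EuclideanSpace ℝ (Fin (n + 1)) =>
      (WithLp.toLp 2 (dropCoord i x) : EuclideanSpace ℝ (Fin n))) := by
    refine LipschitzWith.of_dist_le_mul fun x y => ?_
    rw [NNReal.coe_one, one_mul, EuclideanSpace.dist_eq, EuclideanSpace.dist_eq]
    refine Real.sqrt_le_sqrt ?_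
    rw [Fin.sum_univ_succAbove _ i]
    exact le_add_of_nonneg_left (sq_nonneg _)
  have h := hL.hausdorffMeasure_image_le (d := n) n.cast_nonneg A
  calc volume (dropCoord i '' A)
      = volume ((fun x => (WithLp.toLp 2 (dropCoord i x) : EuclideanSpace ℝ (Fin n))) '' A) := by
        rw [← (EuclideanSpace.volume_preserving_symm_measurableEquiv_toLp
          (Fin n)).measure_preimage_equiv, ← image_image (fun y => WithLp.toLp 2 y)]
        congr 1
        exact ((MeasurableEquiv.toLp 2 (Fin n → ℝ)).image_eq_preimage_symm _).symm
    _ ≤ Measure.euclideanHausdorffMeasure n A := by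
        rw [← EuclideanSpace.euclideanHausdorffMeasure_eq_volume,
          Measure.euclideanHausdorffMeasure_def, Measure.euclideanHausdorffMeasure_def]
        simp only [Measure.smul_apply]
        gcongr
        simpa using h

/-- One half of the divergence theorem: the integral of a partial derivative over a bounded open set
is controlled by the integral of the function over the boundary. -/
theorem enorm_setIntegral_partialDeriv_le {n : ℕ} {Ω : Set (EuclideanSpace ℝ (Fin (n + 1)))}
    (hΩ : IsOpen Ω) (hb : Bornology.IsBounded Ω) (i : Fin (n + 1))
    {f f' : EuclideanSpace ℝ (Fin (n + 1)) → ℝ} (hf : Continuous f) (hf' : Continuous f')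
    (hder : ∀ x, HasLineDerivAt ℝ f (f' x) x (EuclideanSpace.single i 1)) :
    ‖∫ x in Ω, f' x‖ₑ ≤
      2 * ∫⁻ x in frontier Ω, ‖f x‖ₑ ∂(Measure.euclideanHausdorffMeasure n) := by
  let F : ℝ × (Fin n → ℝ) → ℝ := fun z => Ω.indicator f' (coordLine i z.2 z.1)
  let e := (MeasurableEquiv.toLp 2 (Fin (n + 1) → ℝ)).symm.trans
    (MeasurableEquiv.piFinSuccAbove (fun _ => ℝ) i)
  have he : MeasurePreserving e.symm := ((volume_preserving_piFinSuccAbove (fun _ => ℝ) i).comp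
    (EuclideanSpace.volume_preserving_symm_measurableEquiv_toLp (Fin (n + 1)))).symm e
  have hint : Integrable (Ω.indicator f') :=
    ((hf'.continuousOn.integrableOn_compact hb.isCompact_closure).mono_set
      subset_closure).integrable_indicator hΩ.measurableSet
  have hF : Integrable F (volume.prod volume) := he.integrable_comp_of_integrable hint
  have h1 : ∫ x in Ω, f' x = ∫ y, ∫ r, F (r, y) := by
    rw [← integral_indicator hΩ.measurableSet, ← he.integral_comp' (Ω.indicator f')]
    exact integral_prod_symm F hF
  have hΩy : ∀ y, IsOpen (coordLine i y ⁻¹' Ω) := fun y => hΩ.preimage (continuous_coordLine i y)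
  have h2 : ∀ y, ∫ r, F (r, y) = ∫ r in coordLine i y ⁻¹' Ω, f' (coordLine i y r) := fun y => by
    rw [← integral_indicator (hΩy y).measurableSet]
    rfl
  have hline : ∀ y, ‖∫ r, F (r, y)‖ₑ ≤
      2 * ∑' x : ↥(frontier Ω ∩ dropCoord i ⁻¹' {y}), ‖f x‖ₑ := fun y => by
    rw [h2]
    have hby : Bornology.IsBounded (coordLine i y ⁻¹' Ω) := by
      obtain ⟨R, hR⟩ := hb.subset_closedBall 0
      refine (Metric.isBounded_closedBall (x := (0 : ℝ)) (r := R)).subset fun r hr => ?_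
      have := hR hr
      rw [mem_closedBall_zero_iff] at this ⊢
      refine le_trans ?_ this
      simpa only [coordLine_apply_self] using PiLp.norm_apply_le (coordLine i y r) i
    refine (enorm_setIntegral_deriv_le_tsum_frontier (f := fun r => f (coordLine i y r)) (hΩy y) hby
      (fun r => ?_) (hf'.comp (continuous_coordLine i y))).trans ?_
    -- The line derivative is taken at parameter `0` of the line based at `coordLine i y r`;
    -- shifting the parameter by `r` gives the derivative at `r`.
    · have := hder (coordLine i y r)
      rw [HasLineDerivAt] at this
      simp_rw [← coordLine_add] at this
      rw [← sub_self r] at this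
      have h := HasDerivAt.comp_sub_const r r this
      simp only [add_sub_cancel] at h
      exact h
    · gcongr
      -- Only this inclusion is needed: a line may also touch `∂Ω` at points that are not endpoints,
      -- and these only enlarge the sum.
      have hfr : ∀ r ∈ frontier (coordLine i y ⁻¹' Ω), coordLine i y r ∈ frontier Ω :=
        fun r hr => (continuous_coordLine i y).frontier_preimage_subset Ω hr
      refine ENNReal.tsum_comp_le_tsum_of_injective
        (f := fun r : frontier (coordLine i y ⁻¹' Ω) =>
          (⟨coordLine i y r, hfr r r.2, dropCoord_coordLine i y r⟩ :
            ↥(frontier Ω ∩ dropCoord i ⁻¹' {y})))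
        (fun r r' h => Subtype.ext ?_) (fun x => ‖f x‖ₑ)
      have := Subtype.ext_iff.1 h
      rw [← coordLine_apply_self i y r, ← coordLine_apply_self i y r']
      exact congrArg (fun x : EuclideanSpace ℝ (Fin (n + 1)) => x i) this
  calc ‖∫ x in Ω, f' x‖ₑ ≤ ∫⁻ y, ‖∫ r, F (r, y)‖ₑ := h1 ▸ enorm_integral_le_lintegral_enorm _
    _ ≤ ∫⁻ y, 2 * ∑' x : ↥(frontier Ω ∩ dropCoord i ⁻¹' {y}), ‖f x‖ₑ := lintegral_mono hline
    _ = 2 * ∫⁻ y, ∑' x : ↥(frontier Ω ∩ dropCoord i ⁻¹' {y}), ‖f x‖ₑ :=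
        lintegral_const_mul' _ _ (by simp)
    _ ≤ _ := by
      gcongr
      exact lintegral_tsum_fiber_le (volume_dropCoord_image_le i) isClosed_frontier.measurableSet
        hf.enorm

/-! ### Calculus and energy inequality for smooth functions -/

theorem hasDerivAt_intervalIntegral_of_continuous {F F' : ℝ → ℝ → ℝ} (hF : Continuous F.uncurry)
    (hF' : Continuous F'.uncurry) (h : ∀ r s, HasDerivAt (fun r => F r s) (F' r s) r)
    (a b r₀ : ℝ) :
    HasDerivAt (fun r => ∫ s in a..b, F r s) (∫ s in a..b, F' r₀ s) r₀ := by
  obtain ⟨C, hC⟩ := ((isCompact_closedBall r₀ 1).prod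
    (isCompact_uIcc (a := a) (b := b))).exists_bound_of_continuousOn hF'.continuousOn
  have hFr : ∀ r, Continuous (F r) := fun r => hF.comp (by fun_prop : Continuous fun s => (r, s))
  have hFr' : ∀ r, Continuous (F' r) := fun r => hF'.comp (by fun_prop : Continuous fun s => (r, s))
  refine (intervalIntegral.hasDerivAt_integral_of_dominated_loc_of_deriv_le (bound := fun _ => C)
    (Metric.ball_mem_nhds r₀ one_pos) (Eventually.of_forall fun r => (hFr r).aestronglyMeasurable)
    ((hFr r₀).intervalIntegrable _ _) (hFr' r₀).aestronglyMeasurable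
    (Eventually.of_forall fun s hs r hr => ?_) intervalIntegrable_const
    (Eventually.of_forall fun s _ r _ => h r s)).2
  exact hC (r, s) ⟨Metric.ball_subset_closedBall hr, uIoc_subset_uIcc hs⟩

section

variable {d : ℕ} {φ : EuclideanSpace ℝ (Fin d) × ℝ → ℝ}

/-- The `i`-th spatial partial derivative is a component of the gradient. -/
theorem hasDerivAt_line_spaceGrad (hφ : Differentiable ℝ φ) (i : Fin d)
    (x : EuclideanSpace ℝ (Fin d)) (r s : ℝ) :
    HasDerivAt (fun r => φ (x + r • EuclideanSpace.single i (1 : ℝ), s))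
      (spaceGrad φ (x + r • EuclideanSpace.single i (1 : ℝ), s) i) r := by
  have hd : DifferentiableAt ℝ (fun y => φ (y, s)) (x + r • EuclideanSpace.single i (1 : ℝ)) := by
    fun_prop
  have h1 := hd.hasFDerivAt.comp_hasDerivAt r
    ((hasDerivAt_id r).smul_const (EuclideanSpace.single i (1 : ℝ)) |>.const_add x)
  rw [one_smul, ← inner_gradient_left, EuclideanSpace.inner_single_right] at h1
  simp only [id_eq, one_mul] at h1
  exact h1

theorem hasDerivAt_timeDeriv (hφ : Differentiable ℝ φ) (x : EuclideanSpace ℝ (Fin d)) (s : ℝ) :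
    HasDerivAt (fun s => φ (x, s)) (timeDeriv φ (x, s)) s := by
  have : DifferentiableAt ℝ (fun s => φ (x, s)) s := by fun_prop
  exact this.hasDerivAt

/-- The derivative is defined slice by slice; joint continuity in `(x,t)` comes from identifying it
with a value of the full differential. -/
theorem continuous_timeDeriv (hφ : ContDiff ℝ ∞ φ) : Continuous (timeDeriv φ) := by
  have hd : Differentiable ℝ φ := hφ.differentiable (by simp)
  have h : timeDeriv φ = fun z => fderiv ℝ φ z (0, 1) := by
    ext z
    refine (hasDerivAt_timeDeriv hd z.1 z.2).unique ?_
    exact (hd z).hasFDerivAt.comp_hasDerivAt z.2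
      ((hasDerivAt_const z.2 z.1).prodMk (hasDerivAt_id z.2))
  rw [h]
  exact (hφ.continuous_fderiv (by simp)).clm_apply continuous_const

theorem continuous_spaceGrad (hφ : ContDiff ℝ ∞ φ) : Continuous (spaceGrad φ) := by
  have hd : Differentiable ℝ φ := hφ.differentiable (by simp)
  have h : ∀ i, (fun z => spaceGrad φ z i) =
      fun z => fderiv ℝ φ z (EuclideanSpace.single i 1, 0) := fun i => by
    ext z
    have h1 := hasDerivAt_line_spaceGrad hd i z.1 0 z.2
    have h2 := HasFDerivAt.comp_hasDerivAt_of_eq (x := (0 : ℝ)) (hl := (hd z).hasFDerivAt)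
      (f := fun r : ℝ => (z.1 + r • EuclideanSpace.single i (1 : ℝ), z.2))
      (((hasDerivAt_id (0 : ℝ)).smul_const (EuclideanSpace.single i (1 : ℝ)) |>.const_add
        z.1).prodMk (hasDerivAt_const 0 z.2)) (by simp)
    simpa using h1.unique h2
  have : spaceGrad φ = fun z => WithLp.toLp 2 fun i => spaceGrad φ z i := rfl
  rw [this]
  refine (PiLp.continuous_toLp 2 _).comp (continuous_pi fun i => ?_)
  rw [h i]
  exact (hφ.continuous_fderiv (by simp)).clm_apply continuous_const

theorem sq_sub_sq_eq_integral (hφ : ContDiff ℝ ∞ φ) (x : EuclideanSpace ℝ (Fin d)) (s t : ℝ) :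
    φ (x, t) ^ 2 - φ (x, s) ^ 2 = ∫ r in s..t, 2 * φ (x, r) * timeDeriv φ (x, r) := by
  have hd : Differentiable ℝ φ := hφ.differentiable (by simp)
  have hc := continuous_timeDeriv hφ
  have hc' := hφ.continuous
  refine (intervalIntegral.integral_eq_sub_of_hasDerivAt (f := fun r => φ (x, r) ^ 2)
    (fun r _ => ?_) (Continuous.intervalIntegrable (by fun_prop) _ _)).symm
  have h := (hasDerivAt_timeDeriv hd x r).pow 2
  simp only [Nat.cast_ofNat, Nat.add_one_sub_one, pow_one] at h
  exact h

end

/-- The spatial part of the transport operator, integrated against `2 φ`, only sees the values of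
`φ` on the lateral boundary. -/
theorem enorm_integral_spaceGrad_le {n : ℕ} {Ω : Set (EuclideanSpace ℝ (Fin (n + 1)))}
    (hΩ : IsOpen Ω) (hb : Bornology.IsBounded Ω) {T t M : ℝ} (ht : t ∈ Icc 0 T)
    {h : ℝ → ℝ} (hh : Continuous h) (hM : ∀ s, |h s| ≤ M)
    {φ : EuclideanSpace ℝ (Fin (n + 1)) × ℝ → ℝ} (hφ : ContDiff ℝ ∞ φ) (i : Fin (n + 1)) :
    ‖∫ x in Ω, ∫ s in 0..t, h s * (2 * φ (x, s) * spaceGrad φ (x, s) i)‖ₑ ≤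
      2 * ENNReal.ofReal M * ∫⁻ z, ‖φ z‖ₑ ^ 2 ∂(lateralMeasure Ω T) := by
  have hd : Differentiable ℝ φ := hφ.differentiable (by simp)
  have hc := hφ.continuous
  have hg := continuous_spaceGrad hφ
  have hgi : Continuous fun z => spaceGrad φ z i := by fun_prop
  have hM0 : 0 ≤ M := (abs_nonneg _).trans (hM 0)
  -- Integrating in time first reduces the claim to a single function of `x`; since `h` depends on
  -- time only, `∂ᵢ` falls on `φ²` alone.
  refine (enorm_setIntegral_partialDeriv_le hΩ hb i
    (f := fun x => ∫ s in 0..t, h s * φ (x, s) ^ 2)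
    (intervalIntegral.continuous_parametric_intervalIntegral_of_continuous' (by fun_prop) _ _)
    (intervalIntegral.continuous_parametric_intervalIntegral_of_continuous' (by fun_prop) _ _)
    (fun x => ?_)).trans ?_
  · rw [HasLineDerivAt]
    have := hasDerivAt_intervalIntegral_of_continuous
      (F := fun r s => h s * φ (x + r • EuclideanSpace.single i (1 : ℝ), s) ^ 2)
      (F' := fun r s => h s * (2 * φ (x + r • EuclideanSpace.single i (1 : ℝ), s) *
        spaceGrad φ (x + r • EuclideanSpace.single i (1 : ℝ), s) i))
      (by fun_prop) (by fun_prop)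
      (fun r s => by simpa using ((hasDerivAt_line_spaceGrad hd i x r s).pow 2).const_mul (h s))
      0 t 0
    simpa only [zero_smul, add_zero] using this
  · rw [mul_assoc]
    gcongr
    have hpt : ∀ x, ‖∫ s in 0..t, h s * φ (x, s) ^ 2‖ₑ ≤
        ENNReal.ofReal M * ∫⁻ s in Ioo 0 T, ‖φ (x, s)‖ₑ ^ 2 := fun x => by
      rw [intervalIntegral.integral_of_le ht.1, ← lintegral_const_mul' _ _ (by simp)]
      refine (enorm_integral_le_lintegral_enorm _).trans ?_
      rw [restrict_Ioo_eq_restrict_Ioc]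
      refine (lintegral_mono fun s => ?_).trans (lintegral_mono_set (Ioc_subset_Ioc_right ht.2))
      rw [enorm_mul, enorm_pow]
      gcongr
      rw [Real.enorm_eq_ofReal_abs]
      exact ENNReal.ofReal_le_ofReal (hM s)
    calc ∫⁻ x in frontier Ω, ‖∫ s in 0..t, h s * φ (x, s) ^ 2‖ₑ
          ∂(Measure.euclideanHausdorffMeasure n)
        ≤ ∫⁻ x in frontier Ω, (ENNReal.ofReal M * ∫⁻ s in Ioo 0 T, ‖φ (x, s)‖ₑ ^ 2)
          ∂(Measure.euclideanHausdorffMeasure n) := lintegral_mono hpt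
      _ = _ := by
        rw [lintegral_const_mul' _ _ (by simp)]
        unfold lateralMeasure
        rw [lintegral_prod]
        · rfl
        · exact (by fun_prop : Continuous fun z => ‖φ z‖ₑ ^ 2).measurable.aemeasurable

/-- The energy inequality for smooth functions. -/
theorem enorm_energy_sub_le {n : ℕ} {Ω : Set (EuclideanSpace ℝ (Fin (n + 1)))}
    (hΩ : IsOpen Ω) (hb : Bornology.IsBounded Ω) {T t M : ℝ} (ht : t ∈ Icc 0 T)
    {H : ℝ → EuclideanSpace ℝ (Fin (n + 1))} (hH : Continuous H) (hM : ∀ s, ‖H s‖ ≤ M)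
    {φ : EuclideanSpace ℝ (Fin (n + 1)) × ℝ → ℝ} (hφ : ContDiff ℝ ∞ φ) :
    ‖(∫ x in Ω, φ (x, t) ^ 2) - ∫ x in Ω, φ (x, 0) ^ 2‖ₑ ≤
      2 * ∫⁻ z, ‖φ z‖ₑ * ‖timeDeriv φ z + inner ℝ (H z.2) (spaceGrad φ z)‖ₑ ∂(cylinderMeasure Ω T) +
      (n + 1) * (2 * ENNReal.ofReal M) * ∫⁻ z, ‖φ z‖ₑ ^ 2 ∂(lateralMeasure Ω T) := by
  have hc := hφ.continuous
  have hg := continuous_spaceGrad hφ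
  have hgi : ∀ i, Continuous fun z => spaceGrad φ z i := fun i => by fun_prop
  have hHi : ∀ i, Continuous fun s => H s i := fun i => by fun_prop
  have ht' := continuous_timeDeriv hφ
  have hint : ∀ {f : EuclideanSpace ℝ (Fin (n + 1)) → ℝ}, Continuous f → IntegrableOn f Ω :=
    fun hf => (hf.continuousOn.integrableOn_compact hb.isCompact_closure).mono_set subset_closure
  have hpar : ∀ {f : EuclideanSpace ℝ (Fin (n + 1)) → ℝ → ℝ}, Continuous f.uncurry →
      Continuous fun x => ∫ s in 0..t, f x s := fun hf =>
    intervalIntegral.continuous_parametric_intervalIntegral_of_continuous' hf _ _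
  have hinner : ∀ s y, inner ℝ (H s) y = ∑ i, H s i * y i := fun s y => by
    rw [PiLp.inner_apply]; simp [mul_comm]
  -- The residual of `φ` in the transport equation: `∂ₜ(φ²) = 2φD - ∑ Hᵢ ∂ᵢ(φ²)`.
  set D : EuclideanSpace ℝ (Fin (n + 1)) × ℝ → ℝ :=
    fun z => timeDeriv φ z + inner ℝ (H z.2) (spaceGrad φ z) with hD
  have hDc : Continuous D := by fun_prop
  have key : (∫ x in Ω, φ (x, t) ^ 2) - ∫ x in Ω, φ (x, 0) ^ 2 =
      (∫ x in Ω, ∫ s in 0..t, 2 * φ (x, s) * D (x, s)) -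
        ∑ i, ∫ x in Ω, ∫ s in 0..t, H s i * (2 * φ (x, s) * spaceGrad φ (x, s) i) := by
    rw [← integral_finsetSum _ fun i _ => hint (hpar (by fun_prop)),
      ← integral_sub (hint (by fun_prop)) (hint (by fun_prop)),
      ← integral_sub (hint (hpar (by fun_prop)))
        (integrable_finsetSum _ fun i _ => hint (hpar (by fun_prop)))]
    refine integral_congr_ae (Eventually.of_forall fun x => ?_)
    simp only
    rw [sq_sub_sq_eq_integral hφ, ← intervalIntegral.integral_finsetSum
      fun i _ => Continuous.intervalIntegrable (by fun_prop) _ _,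
      ← intervalIntegral.integral_sub (Continuous.intervalIntegrable (by fun_prop) _ _)
        (Continuous.intervalIntegrable (by fun_prop) _ _)]
    refine intervalIntegral.integral_congr fun s _ => ?_
    simp only [hD, hinner, mul_add, Finset.mul_sum]
    rw [add_sub_assoc, left_eq_add, sub_eq_zero]
    exact Finset.sum_congr rfl fun i _ => by ring
  rw [key]
  refine enorm_sub_le.trans (add_le_add ?_ ?_)
  · rw [cylinderMeasure, cylinder, Measure.volume_eq_prod, ← Measure.prod_restrict, lintegral_prod,
      ← lintegral_const_mul' _ _ (by simp)]
    · refine (enorm_integral_le_lintegral_enorm _).trans (lintegral_mono fun x => ?_)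
      rw [intervalIntegral.integral_of_le ht.1, ← lintegral_const_mul' _ _ (by simp)]
      refine (enorm_integral_le_lintegral_enorm _).trans ?_
      rw [restrict_Ioo_eq_restrict_Ioc]
      refine (lintegral_mono fun s => ?_).trans (lintegral_mono_set (Ioc_subset_Ioc_right ht.2))
      rw [enorm_mul, enorm_mul, mul_assoc, Real.enorm_eq_ofReal two_pos.le, ENNReal.ofReal_ofNat]
    · exact (hc.enorm.measurable.mul hDc.enorm.measurable).aemeasurable
  · refine (enorm_sum_le _ _).trans ((Finset.sum_le_sum fun i _ =>
      enorm_integral_spaceGrad_le hΩ hb ht (hHi i) (M := M) (fun s => ?_) hφ i).trans ?_)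
    · exact (PiLp.norm_apply_le (H s) i).trans (hM s)
    · simp [mul_assoc]

/-! ### Time slices of `H¹` functions -/

theorem eLpNorm_two_sq {α F : Type*} [MeasurableSpace α] [NormedAddCommGroup F] (f : α → F)
    (μ : Measure α) : eLpNorm f 2 μ ^ 2 = ∫⁻ x, ‖f x‖ₑ ^ 2 ∂μ := by
  simpa using eLpNorm_nnreal_pow_eq_lintegral (f := f) (μ := μ) (p := 2) two_ne_zero

/-- Fatou's lemma; it spares the extraction of an almost everywhere convergent subsequence. -/
theorem ae_liminf_eq_zero {α : Type*} [MeasurableSpace α] {μ : Measure α} {g : ℕ → α → ℝ≥0∞}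
    (hg : ∀ n, AEMeasurable (g n) μ) (h : Tendsto (fun n => ∫⁻ s, g n s ∂μ) atTop (𝓝 0)) :
    ∀ᵐ s ∂μ, liminf (fun n => g n s) atTop = 0 := by
  have hle := lintegral_liminf_le (μ := μ) (u := atTop) fun n => (hg n).measurable_mk
  simp_rw [← fun n => lintegral_congr_ae (hg n).ae_eq_mk, h.liminf_eq] at hle
  rw [nonpos_iff_eq_zero, lintegral_eq_zero_iff (Measurable.liminf fun n => (hg n).measurable_mk)]
    at hle
  filter_upwards [hle, ae_all_iff.2 fun n => (hg n).ae_eq_mk] with s hs hs'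
  simpa [hs'] using hs

section

variable {d : ℕ} {Ω : Set (EuclideanSpace ℝ (Fin d))} {T : ℝ}

theorem cylinderMeasure_eq_prod :
    cylinderMeasure Ω T = (volume.restrict Ω).prod (volume.restrict (Ioo 0 T)) := by
  unfold cylinderMeasure cylinder
  rw [Measure.volume_eq_prod, Measure.prod_restrict]

theorem lintegral_cylinder {f : EuclideanSpace ℝ (Fin d) × ℝ → ℝ≥0∞}
    (hf : AEMeasurable f (cylinderMeasure Ω T)) :
    ∫⁻ z, f z ∂(cylinderMeasure Ω T) = ∫⁻ s in Ioo 0 T, ∫⁻ x in Ω, f (x, s) := by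
  rw [cylinderMeasure_eq_prod] at hf ⊢
  exact lintegral_prod_symm _ hf

theorem lintegral_cylinder' {f : EuclideanSpace ℝ (Fin d) × ℝ → ℝ≥0∞}
    (hf : AEMeasurable f (cylinderMeasure Ω T)) :
    ∫⁻ z, f z ∂(cylinderMeasure Ω T) = ∫⁻ x in Ω, ∫⁻ s in Ioo 0 T, f (x, s) := by
  rw [cylinderMeasure_eq_prod] at hf ⊢
  exact lintegral_prod _ hf

variable {φ : EuclideanSpace ℝ (Fin d) × ℝ → ℝ}

theorem enorm_two_mul_mul_le (a b : ℝ) : ‖2 * a * b‖ₑ ≤ ‖a‖ₑ ^ 2 + ‖b‖ₑ ^ 2 := by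
  rw [← enorm_pow, ← enorm_pow, Real.enorm_eq_ofReal_abs, Real.enorm_eq_ofReal (sq_nonneg a),
    Real.enorm_eq_ofReal (sq_nonneg b), ← ENNReal.ofReal_add (sq_nonneg a) (sq_nonneg b)]
  refine ENNReal.ofReal_le_ofReal (abs_le.2 ⟨?_, ?_⟩) <;> nlinarith [sq_nonneg (a - b),
    sq_nonneg (a + b)]

/-- The fundamental theorem of calculus for `φ²`, with `2|ab| ≤ a² + b²`. The time `s` is left free
so that it can be averaged out. -/
theorem enorm_sq_le_enorm_sq_add (hφ : ContDiff ℝ ∞ φ) (x : EuclideanSpace ℝ (Fin d)) {s t : ℝ}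
    (hs : s ∈ Icc 0 T) (ht : t ∈ Icc 0 T) :
    ‖φ (x, t)‖ₑ ^ 2 ≤ ‖φ (x, s)‖ₑ ^ 2 +
      ∫⁻ r in Ioo 0 T, (‖φ (x, r)‖ₑ ^ 2 + ‖timeDeriv φ (x, r)‖ₑ ^ 2) := by
  have h : φ (x, t) ^ 2 = φ (x, s) ^ 2 + ∫ r in s..t, 2 * φ (x, r) * timeDeriv φ (x, r) := by
    rw [← sq_sub_sq_eq_integral hφ]; ring
  rw [← enorm_pow, h, ← enorm_pow]
  refine (enorm_add_le _ _).trans ?_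
  gcongr
  rw [← ofReal_norm, intervalIntegral.norm_integral_eq_norm_integral_uIoc, ofReal_norm,
    restrict_Ioo_eq_restrict_Ioc]
  refine (enorm_integral_le_lintegral_enorm _).trans ((lintegral_mono fun r =>
    enorm_two_mul_mul_le _ _).trans (lintegral_mono_set ?_))
  exact Ioc_subset_Ioc (le_min hs.1 ht.1) (max_le hs.2 ht.2)

/-- The `L²` norm of every time slice is controlled by the norm in `H¹(0,T; L²(Ω))`. -/
theorem eLpNorm_slice_sq_le (hφ : ContDiff ℝ ∞ φ) {t : ℝ} (ht : t ∈ Icc 0 T) :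
    ENNReal.ofReal T * eLpNorm (fun x => φ (x, t)) 2 (volume.restrict Ω) ^ 2 ≤
      eLpNorm φ 2 (cylinderMeasure Ω T) ^ 2 + ENNReal.ofReal T *
        (eLpNorm φ 2 (cylinderMeasure Ω T) ^ 2 +
          eLpNorm (timeDeriv φ) 2 (cylinderMeasure Ω T) ^ 2) := by
  have hm : Measurable fun z => ‖φ z‖ₑ ^ 2 := hφ.continuous.enorm.measurable.pow_const 2
  have hm' : Measurable fun z => ‖timeDeriv φ z‖ₑ ^ 2 :=
    (continuous_timeDeriv hφ).enorm.measurable.pow_const 2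
  -- The factor `T` is read as an integral over `s ∈ (0,T)`, which averages the preceding pointwise
  -- bound over `s`.
  have hvol : ∀ c : ℝ≥0∞, ∫⁻ _ in Ioo 0 T, c = ENNReal.ofReal T * c := fun c => by
    rw [setLIntegral_const, Real.volume_Ioo, sub_zero, mul_comm]
  simp_rw [eLpNorm_two_sq]
  rw [← lintegral_add_left hm, ← hvol, ← hvol, lintegral_cylinder hm.aemeasurable,
    lintegral_cylinder' (f := fun z => ‖φ z‖ₑ ^ 2 + ‖timeDeriv φ z‖ₑ ^ 2) (hm.add hm').aemeasurable,
    ← lintegral_add_right _ measurable_const]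
  refine setLIntegral_mono' measurableSet_Ioo fun s hs => ?_
  rw [← lintegral_add_left (f := fun x => ‖φ (x, s)‖ₑ ^ 2)
    (hm.comp (by fun_prop : Measurable fun x => (x, s)))]
  exact lintegral_mono fun x => enorm_sq_le_enorm_sq_add hφ x (Ioo_subset_Icc_self hs) ht

theorem isFiniteMeasure_restrict (hb : Bornology.IsBounded Ω) :
    IsFiniteMeasure (volume.restrict Ω) :=
  ⟨by rw [Measure.restrict_apply_univ]; exact hb.measure_lt_top⟩

theorem exists_bound_on_cylinder (hb : Bornology.IsBounded Ω) (T : ℝ)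
    {f : EuclideanSpace ℝ (Fin d) × ℝ → ℝ} (hf : Continuous f) :
    ∃ M, ∀ x ∈ Ω, ∀ t ∈ Icc 0 T, ‖f (x, t)‖ ≤ M := by
  obtain ⟨M, hM⟩ := (hb.isCompact_closure.prod
    (isCompact_Icc (a := (0 : ℝ)) (b := T))).exists_bound_of_continuousOn hf.continuousOn
  exact ⟨M, fun x hx t ht => hM (x, t) ⟨subset_closure hx, ht⟩⟩

theorem memLp_of_continuous (hΩ : IsOpen Ω) (hb : Bornology.IsBounded Ω)
    {f : EuclideanSpace ℝ (Fin d) → ℝ} (hf : Continuous f) : MemLp f 2 (volume.restrict Ω) := by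
  have := isFiniteMeasure_restrict hb
  obtain ⟨M, hM⟩ := hb.isCompact_closure.exists_bound_of_continuousOn hf.continuousOn
  exact MemLp.of_bound hf.aestronglyMeasurable M
    (ae_restrict_of_forall_mem hΩ.measurableSet fun x hx => hM x (subset_closure hx))

theorem memLp_slice (hΩ : IsOpen Ω) (hb : Bornology.IsBounded Ω) (hφ : Continuous φ) (t : ℝ) :
    MemLp (fun x => φ (x, t)) 2 (volume.restrict Ω) :=
  memLp_of_continuous hΩ hb (by fun_prop)

/-- `∂ₜφ` is bounded on the bounded cylinder, so `t ↦ φ(x,t)` is Lipschitz uniformly in `x`, and `Ω`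
has finite measure. -/
theorem continuousOn_slice (hΩ : IsOpen Ω) (hb : Bornology.IsBounded Ω) (hφ : ContDiff ℝ ∞ φ) :
    ContinuousOn (fun t => (memLp_slice hΩ hb hφ.continuous t).toLp) (Icc 0 T) := by
  have := isFiniteMeasure_restrict hb
  obtain ⟨M, hM⟩ := exists_bound_on_cylinder hb T (continuous_timeDeriv hφ)
  have hlip : ∀ x ∈ Ω, ∀ s ∈ Icc 0 T, ∀ t ∈ Icc 0 T,
      ‖φ (x, s) - φ (x, t)‖ ≤ max M 0 * ‖s - t‖ := fun x hx s hs t ht =>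
    (convex_Icc 0 T).norm_image_sub_le_of_norm_hasDerivWithin_le (f := fun s => φ (x, s))
      (fun r _ => (hasDerivAt_timeDeriv (hφ.differentiable (by simp)) x r).hasDerivWithinAt)
      (fun r hr => (hM x hx r hr).trans (le_max_left _ _)) ht hs
  refine LipschitzOnWith.continuousOn (K := Real.toNNReal
    ((measureUnivNNReal (volume.restrict Ω) : ℝ) ^ (2 : ℝ≥0∞).toReal⁻¹ * max M 0))
    (LipschitzOnWith.of_dist_le_mul fun s hs t ht => ?_)
  rw [Real.coe_toNNReal _ (by positivity), dist_eq_norm, ← MemLp.toLp_sub, mul_assoc, dist_eq_norm]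
  refine Lp.norm_le_of_ae_bound (by positivity) ?_
  filter_upwards [MemLp.coeFn_toLp ((memLp_slice hΩ hb hφ.continuous s).sub
    (memLp_slice hΩ hb hφ.continuous t)), ae_restrict_mem hΩ.measurableSet] with x hx hxΩ
  rw [hx]
  exact hlip x hxΩ s hs t ht

/-- A function that is approximated in `H¹(0,T; L²(Ω))` by smooth functions has a representative in
`C([0,T]; L²(Ω))`, and the time slices of the approximations converge. -/
theorem exists_isTimeSlice (hΩ : IsOpen Ω) (hb : Bornology.IsBounded Ω) (hT : 0 < T)
    {u ut : EuclideanSpace ℝ (Fin d) × ℝ → ℝ} (hu : MemLp u 2 (cylinderMeasure Ω T))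
    (hut : MemLp ut 2 (cylinderMeasure Ω T))
    {φ : ℕ → EuclideanSpace ℝ (Fin d) × ℝ → ℝ} (hφ : ∀ n, ContDiff ℝ ∞ (φ n))
    (h0 : Tendsto (fun n => eLpNorm (fun z => φ n z - u z) 2 (cylinderMeasure Ω T)) atTop (𝓝 0))
    (h1 : Tendsto (fun n => eLpNorm (fun z => timeDeriv (φ n) z - ut z) 2 (cylinderMeasure Ω T))
      atTop (𝓝 0)) :
    ∃ v : ℝ → Lp ℝ 2 (volume.restrict Ω), IsTimeSlice Ω T u v ∧ ∀ t ∈ Icc 0 T,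
      Tendsto (fun n => (memLp_slice hΩ hb (hφ n).continuous t).toLp) atTop (𝓝 (v t)) := by
  set V : ℕ → ℝ → Lp ℝ 2 (volume.restrict Ω) :=
    fun n t => (memLp_slice hΩ hb (hφ n).continuous t).toLp with hV
  set a := fun n => eLpNorm (fun z => φ n z - u z) 2 (cylinderMeasure Ω T) with ha
  set b := fun n => eLpNorm (fun z => timeDeriv (φ n) z - ut z) 2 (cylinderMeasure Ω T) with hb'
  -- The right-hand side does not involve `t`, so the slices are Cauchy uniformly on `[0,T]`.
  have hdiff : ∀ n m, ∀ t ∈ Icc 0 T, ENNReal.ofReal T * ‖V n t - V m t‖ₑ ^ 2 ≤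
      (a n + a m) ^ 2 + ENNReal.ofReal T * ((a n + a m) ^ 2 + (b n + b m) ^ 2) := by
    intro n m t ht
    have hs : ContDiff ℝ ∞ fun z => φ n z - φ m z := (hφ n).sub (hφ m)
    have htd : timeDeriv (fun z => φ n z - φ m z) =
        fun z => timeDeriv (φ n) z - timeDeriv (φ m) z := by
      ext z
      exact ((hasDerivAt_timeDeriv ((hφ n).differentiable (by simp)) z.1 z.2).sub
        (hasDerivAt_timeDeriv ((hφ m).differentiable (by simp)) z.1 z.2)).deriv
    have e1 : ‖V n t - V m t‖ₑ =
        eLpNorm (fun x => φ n (x, t) - φ m (x, t)) 2 (volume.restrict Ω) := by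
      rw [hV, ← MemLp.toLp_sub, Lp.enorm_toLp]
      rfl
    have tri : ∀ {f g w : EuclideanSpace ℝ (Fin d) × ℝ → ℝ}, Continuous f → Continuous g →
        MemLp w 2 (cylinderMeasure Ω T) →
        eLpNorm (fun z => f z - g z) 2 (cylinderMeasure Ω T) ≤
          eLpNorm (fun z => f z - w z) 2 (cylinderMeasure Ω T) +
          eLpNorm (fun z => g z - w z) 2 (cylinderMeasure Ω T) := by
      intro f g w hf hg hw
      have : (fun z => f z - g z) = (fun z => f z - w z) - fun z => g z - w z := by
        ext z; simp
      rw [this]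
      exact eLpNorm_sub_le (hf.aestronglyMeasurable.sub hw.aestronglyMeasurable)
        (hg.aestronglyMeasurable.sub hw.aestronglyMeasurable) one_le_two
    rw [e1]
    refine (eLpNorm_slice_sq_le hs ht).trans ?_
    rw [htd]
    have A := tri (hφ n).continuous (hφ m).continuous hu
    have B := tri (continuous_timeDeriv (hφ n)) (continuous_timeDeriv (hφ m)) hut
    gcongr
  have hcauchy : UniformCauchySeqOn V atTop (Icc 0 T) := by
    have hlim : Tendsto (fun q : ℕ × ℕ => (a q.1 + a q.2) ^ 2 + ENNReal.ofReal T *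
        ((a q.1 + a q.2) ^ 2 + (b q.1 + b q.2) ^ 2)) (atTop ×ˢ atTop) (𝓝 0) := by
      have ha2 := (h0.comp tendsto_fst).add (h0.comp (tendsto_snd (f := atTop (α := ℕ))))
      have hb2 := (h1.comp tendsto_fst).add (h1.comp (tendsto_snd (f := atTop (α := ℕ))))
      have ha3 := ((ENNReal.continuous_pow 2).tendsto _).comp ha2
      have hb3 := ((ENNReal.continuous_pow 2).tendsto _).comp hb2
      simpa using ha3.add (ENNReal.Tendsto.const_mul (a := ENNReal.ofReal T) (ha3.add hb3)
        (Or.inr ENNReal.ofReal_ne_top))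
    intro W hW
    obtain ⟨ε, hε, hεW⟩ := mem_uniformity_edist.1 hW
    have hT' : ENNReal.ofReal T ≠ 0 := by simpa using hT
    filter_upwards [hlim.eventually (gt_mem_nhds (show 0 < ENNReal.ofReal T * ε ^ 2 by
      exact ENNReal.mul_pos hT' (by positivity)))] with q hq t ht
    refine hεW ?_
    rw [edist_eq_enorm_sub]
    have := (hdiff q.1 q.2 t ht).trans_lt hq
    rw [ENNReal.mul_lt_mul_iff_right hT' ENNReal.ofReal_ne_top] at this
    exact lt_of_not_ge fun hle => (pow_le_pow_left' hle 2).not_gt this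
  have hex : ∀ t : ℝ, ∃ w, t ∈ Icc 0 T → Tendsto (fun n => V n t) atTop (𝓝 w) := fun t => by
    by_cases ht : t ∈ Icc 0 T
    · obtain ⟨w, hw⟩ := cauchySeq_tendsto_of_complete (hcauchy.cauchySeq ht)
      exact ⟨w, fun _ => hw⟩
    · exact ⟨0, fun h => absurd h ht⟩
  choose v hv using hex
  have hunif := hcauchy.tendstoUniformlyOn_of_tendsto hv
  refine ⟨v, ⟨hunif.continuousOn (Frequently.of_forall fun n =>
    continuousOn_slice hΩ hb (hφ n)), ?_⟩, hv⟩
  have hmeas : ∀ n, AEMeasurable (fun z => ‖φ n z - u z‖ₑ ^ 2) (cylinderMeasure Ω T) := fun n =>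
    ((hφ n).continuous.aestronglyMeasurable.sub hu.aestronglyMeasurable).enorm.pow_const 2
  have hlint : Tendsto (fun n => ∫⁻ s in Ioo 0 T, ∫⁻ x in Ω, ‖φ n (x, s) - u (x, s)‖ₑ ^ 2) atTop
      (𝓝 0) := by
    simp_rw [← fun n => lintegral_cylinder (hmeas n), ← eLpNorm_two_sq]
    have := ((ENNReal.continuous_pow 2).tendsto _).comp h0
    simpa [Function.comp_def, ha] using this
  have hmeas' : ∀ n, AEMeasurable (fun s => ∫⁻ x in Ω, ‖φ n (x, s) - u (x, s)‖ₑ ^ 2)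
      (volume.restrict (Ioo 0 T)) := fun n => by
    have := hmeas n
    rw [cylinderMeasure_eq_prod] at this
    exact this.lintegral_prod_left'
  have hau := hu.aestronglyMeasurable
  rw [cylinderMeasure_eq_prod] at hau
  filter_upwards [ae_liminf_eq_zero hmeas' hlint, hau.prodMk_right,
    ae_restrict_mem measurableSet_Ioo] with s hs hus hsI
  have hsI' := Ioo_subset_Icc_self hsI
  have hdist : ∀ n, edist (V n s) (v s) =
      eLpNorm (fun x => φ n (x, s) - v s x) 2 (volume.restrict Ω) := fun n => by
    rw [Lp.edist_def]
    refine eLpNorm_congr_ae ?_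
    filter_upwards [(memLp_slice hΩ hb (hφ n).continuous s).coeFn_toLp] with x hx
    simp [hV, hx]
  have hc : ∀ n, AEStronglyMeasurable (fun x => φ n (x, s)) (volume.restrict Ω) := fun n =>
    (memLp_slice hΩ hb (hφ n).continuous s).aestronglyMeasurable
  have hvs := (Lp.memLp (v s)).aestronglyMeasurable
  have hzero : eLpNorm (fun x => v s x - u (x, s)) 2 (volume.restrict Ω) = 0 := by
    -- For infinitely many `n` the slice of `φ n` is close to `u(·,s)`, and for all large `n` it is
    -- close to `v s`; one common `n` suffices.
    refine le_antisymm (ENNReal.le_of_forall_pos_le_add fun ε hε _ => ?_) zero_le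
    have hε2 : (0 : ℝ≥0∞) < ε / 2 := ENNReal.half_pos (by simpa using hε.ne')
    have hfreq : ∃ᶠ n in atTop, ∫⁻ x in Ω, ‖φ n (x, s) - u (x, s)‖ₑ ^ 2 < (ε / 2 : ℝ≥0∞) ^ 2 :=
      frequently_lt_of_liminf_lt (by isBoundedDefault) (hs ▸ by positivity)
    obtain ⟨n, hn1, hn2⟩ := (hfreq.and_eventually
      ((EMetric.tendsto_nhds.1 (hv s hsI')) _ hε2)).exists
    rw [← eLpNorm_two_sq] at hn1
    replace hn1 := lt_of_not_ge fun hle => (pow_le_pow_left' hle 2).not_gt hn1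
    rw [hdist] at hn2
    have heq : (fun x => v s x - u (x, s)) =
        (fun x => φ n (x, s) - u (x, s)) - fun x => φ n (x, s) - v s x := by
      ext x; simp
    rw [heq, zero_add]
    refine (eLpNorm_sub_le ((hc n).sub hus) ((hc n).sub hvs) one_le_two).trans ?_
    rw [← ENNReal.add_halves (ε : ℝ≥0∞)]
    exact add_le_add hn1.le hn2.le
  filter_upwards [(eLpNorm_eq_zero_iff (hvs.sub hus) two_ne_zero).1 hzero] with x hx
  exact sub_eq_zero.1 hx

/-- The representative in `C([0,T]; L²(Ω))` is unique. -/
theorem IsTimeSlice.eqOn (hT : 0 < T) {u : EuclideanSpace ℝ (Fin d) × ℝ → ℝ}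
    {v w : ℝ → Lp ℝ 2 (volume.restrict Ω)} (hv : IsTimeSlice Ω T u v) (hw : IsTimeSlice Ω T u w) :
    EqOn v w (Icc 0 T) := by
  refine Measure.eqOn_Icc_of_ae_eq volume hT.ne ?_ hv.1 hw.1
  rw [← restrict_Ioo_eq_restrict_Icc]
  filter_upwards [hv.2, hw.2] with t h1 h2
  exact Lp.ext (h1.trans h2.symm)

end

/-! ### Passage to the limit in the energy inequality -/

theorem lintegral_enorm_mul_le {α : Type*} [MeasurableSpace α] {μ : Measure α} {f g : α → ℝ}
    (hf : AEStronglyMeasurable f μ) (hg : AEStronglyMeasurable g μ) :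
    ∫⁻ x, ‖f x‖ₑ * ‖g x‖ₑ ∂μ ≤ eLpNorm f 2 μ * eLpNorm g 2 μ := by
  have := eLpNorm_smul_le_mul_eLpNorm (p := 2) (q := 2) (r := 1) hg hf
  simpa [eLpNorm_one_eq_lintegral_enorm, enorm_mul] using this

theorem norm_sq_toLp {α : Type*} [MeasurableSpace α] {μ : Measure α} {f : α → ℝ}
    (hf : MemLp f 2 μ) : ‖hf.toLp‖ ^ 2 = ∫ x, f x ^ 2 ∂μ := by
  rw [← real_inner_self_eq_norm_sq, L2.inner_def]
  refine integral_congr_ae ?_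
  filter_upwards [hf.coeFn_toLp] with x hx
  simp [hx, sq]

/-- The energy estimate for the time slices obtained as limits of smooth approximations. -/
theorem enorm_norm_sq_sub_le {n : ℕ} {Ω : Set (EuclideanSpace ℝ (Fin (n + 1)))}
    (hΩ : IsOpen Ω) (hb : Bornology.IsBounded Ω) {T M : ℝ}
    {H : ℝ → EuclideanSpace ℝ (Fin (n + 1))} (hH : Continuous H) (hM : ∀ s, ‖H s‖ ≤ M)
    {u ut : EuclideanSpace ℝ (Fin (n + 1)) × ℝ → ℝ}
    {p : EuclideanSpace ℝ (Fin (n + 1)) × ℝ → EuclideanSpace ℝ (Fin (n + 1))}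
    {g : Lp ℝ 2 (lateralMeasure Ω T)}
    (hu : MemLp u 2 (cylinderMeasure Ω T)) (hut : MemLp ut 2 (cylinderMeasure Ω T))
    (hp : MemLp p 2 (cylinderMeasure Ω T))
    (heq : ∀ᵐ z ∂(cylinderMeasure Ω T), ut z + inner ℝ (H z.2) (p z) = 0)
    {φ : ℕ → EuclideanSpace ℝ (Fin (n + 1)) × ℝ → ℝ} (hφ : ∀ n, ContDiff ℝ ∞ (φ n))
    (h0 : Tendsto (fun n => eLpNorm (fun z => φ n z - u z) 2 (cylinderMeasure Ω T)) atTop (𝓝 0))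
    (h1 : Tendsto (fun n => eLpNorm (fun z => timeDeriv (φ n) z - ut z) 2 (cylinderMeasure Ω T))
      atTop (𝓝 0))
    (h2 : Tendsto (fun n => eLpNorm (fun z => spaceGrad (φ n) z - p z) 2 (cylinderMeasure Ω T))
      atTop (𝓝 0))
    (h3 : Tendsto (fun n => eLpNorm (fun z => φ n z - g z) 2 (lateralMeasure Ω T)) atTop (𝓝 0))
    {v : ℝ → Lp ℝ 2 (volume.restrict Ω)}
    (hv : ∀ t ∈ Icc 0 T,
      Tendsto (fun n => (memLp_slice hΩ hb (hφ n).continuous t).toLp) atTop (𝓝 (v t)))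
    {t : ℝ} (ht : t ∈ Icc 0 T) :
    ‖‖v t‖ ^ 2 - ‖v 0‖ ^ 2‖ₑ ≤ (n + 1) * (2 * ENNReal.ofReal M) * ‖g‖ₑ ^ 2 := by
  set Q := cylinderMeasure Ω T
  have h00 : (0 : ℝ) ∈ Icc 0 T := ⟨le_rfl, ht.1.trans ht.2⟩
  have hlhs : Tendsto (fun k => ‖(∫ x in Ω, φ k (x, t) ^ 2) - ∫ x in Ω, φ k (x, 0) ^ 2‖ₑ) atTop
      (𝓝 ‖‖v t‖ ^ 2 - ‖v 0‖ ^ 2‖ₑ) := by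
    have := (((hv t ht).norm.pow 2).sub ((hv 0 h00).norm.pow 2)).enorm
    simpa only [norm_sq_toLp] using this
  -- Subtracting `ut + H·p = 0` expresses the residual through the approximation errors of the two
  -- derivatives.
  have hres : ∀ k, eLpNorm (fun z => timeDeriv (φ k) z + inner ℝ (H z.2) (spaceGrad (φ k) z)) 2 Q ≤
      eLpNorm (fun z => timeDeriv (φ k) z - ut z) 2 Q +
        ENNReal.ofReal M * eLpNorm (fun z => spaceGrad (φ k) z - p z) 2 Q := fun k => by
    have hm1 : AEStronglyMeasurable (fun z => timeDeriv (φ k) z - ut z) Q :=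
      (continuous_timeDeriv (hφ k)).aestronglyMeasurable.sub hut.aestronglyMeasurable
    have hm2 : AEStronglyMeasurable (fun z => spaceGrad (φ k) z - p z) Q :=
      (continuous_spaceGrad (hφ k)).aestronglyMeasurable.sub hp.aestronglyMeasurable
    have hHz : AEStronglyMeasurable (fun z : EuclideanSpace ℝ (Fin (n + 1)) × ℝ => H z.2) Q :=
      (hH.comp continuous_snd).aestronglyMeasurable
    calc _ = eLpNorm ((fun z => timeDeriv (φ k) z - ut z) +
          fun z => inner ℝ (H z.2) (spaceGrad (φ k) z - p z)) 2 Q := by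
          refine eLpNorm_congr_ae ?_
          filter_upwards [heq] with z hz
          simp only [Pi.add_apply, inner_sub_right]
          linarith
      _ ≤ _ := by
          refine (eLpNorm_add_le hm1 (hHz.inner hm2) one_le_two).trans ?_
          gcongr
          refine eLpNorm_le_mul_eLpNorm_of_ae_le_mul (Eventually.of_forall fun z => ?_) 2
          exact (norm_inner_le_norm _ _).trans
            (mul_le_mul_of_nonneg_right (hM z.2) (norm_nonneg _))
  have hnorm : ∀ k, eLpNorm (φ k) 2 Q ≤ eLpNorm (fun z => φ k z - u z) 2 Q + eLpNorm u 2 Q :=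
    fun k => by
      have h := eLpNorm_add_le ((hφ k).continuous.aestronglyMeasurable.sub hu.aestronglyMeasurable)
        hu.aestronglyMeasurable one_le_two
      rwa [sub_add_cancel] at h
  have hbdry : ∀ k, eLpNorm (φ k) 2 (lateralMeasure Ω T) ≤
      eLpNorm (fun z => φ k z - g z) 2 (lateralMeasure Ω T) + ‖g‖ₑ := fun k => by
    have hgm := (Lp.memLp g).aestronglyMeasurable
    have h := eLpNorm_add_le ((hφ k).continuous.aestronglyMeasurable.sub hgm) hgm one_le_two
    rwa [sub_add_cancel, ← Lp.enorm_def] at h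
  -- The interior term is a bounded factor times a vanishing residual. Finiteness of the norm of `u`
  -- excludes `∞ · 0`.
  have hrhs : Tendsto (fun k =>
      2 * ((eLpNorm (fun z => φ k z - u z) 2 Q + eLpNorm u 2 Q) *
        (eLpNorm (fun z => timeDeriv (φ k) z - ut z) 2 Q +
          ENNReal.ofReal M * eLpNorm (fun z => spaceGrad (φ k) z - p z) 2 Q)) +
      (n + 1) * (2 * ENNReal.ofReal M) *
        (eLpNorm (fun z => φ k z - g z) 2 (lateralMeasure Ω T) + ‖g‖ₑ) ^ 2) atTop
      (𝓝 (2 * ((0 + eLpNorm u 2 Q) * (0 + ENNReal.ofReal M * 0)) +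
        (n + 1) * (2 * ENNReal.ofReal M) * (0 + ‖g‖ₑ) ^ 2)) := by
    refine (ENNReal.Tendsto.const_mul ?_ (Or.inr (by simp))).add
      (ENNReal.Tendsto.const_mul ?_ (Or.inr ?_))
    · exact ENNReal.Tendsto.mul (h0.add tendsto_const_nhds) (Or.inr (by simp))
        (h1.add (ENNReal.Tendsto.const_mul h2 (Or.inr ENNReal.ofReal_ne_top)))
        (Or.inr (by simpa using hu.eLpNorm_ne_top))
    · exact ((ENNReal.continuous_pow 2).tendsto _).comp (h3.add tendsto_const_nhds)
    · exact ENNReal.mul_ne_top (by finiteness) (by finiteness)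
  refine (le_of_tendsto_of_tendsto' hlhs hrhs fun k => ?_).trans (by simp)
  refine (enorm_energy_sub_le hΩ hb ht hH hM (hφ k)).trans ?_
  rw [← eLpNorm_two_sq]
  have hD : Continuous fun z : EuclideanSpace ℝ (Fin (n + 1)) × ℝ =>
      timeDeriv (φ k) z + inner ℝ (H z.2) (spaceGrad (φ k) z) := by
    have := continuous_timeDeriv (hφ k)
    have := continuous_spaceGrad (hφ k)
    fun_prop
  gcongr
  · exact (lintegral_enorm_mul_le (hφ k).continuous.aestronglyMeasurable
      hD.aestronglyMeasurable).trans (mul_le_mul' (hnorm k) (hres k))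
  · exact hbdry k

end Transport

/-! ### The energy estimate and its consequence for observability -/

theorem proposition2p2 {d : ℕ} (hd : 1 ≤ d) (Ω : Set (EuclideanSpace ℝ (Fin d)))
    (hΩ : Transport.IsSmoothBoundedDomain Ω) (T : ℝ) (hT : 0 < T)
    (H : ℝ → EuclideanSpace ℝ (Fin d)) (hH : ContinuousOn H (Set.Icc 0 T)) :
    -- solutions have well-defined time slices
    (∀ (g : Lp ℝ 2 (Transport.lateralMeasure Ω T)) (u : EuclideanSpace ℝ (Fin d) × ℝ → ℝ),
      Transport.IsSolution Ω T H g u →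
        ∃ v : ℝ → Lp ℝ 2 (volume.restrict Ω), Transport.IsTimeSlice Ω T u v) ∧
    -- energy estimate
    (∃ C : ℝ, 0 < C ∧
      ∀ (g : Lp ℝ 2 (Transport.lateralMeasure Ω T)) (u : EuclideanSpace ℝ (Fin d) × ℝ → ℝ)
        (v : ℝ → Lp ℝ 2 (volume.restrict Ω)),
        Transport.IsSolution Ω T H g u → Transport.IsTimeSlice Ω T u v →
          ∀ t ∈ Set.Icc 0 T, |‖v t‖ ^ 2 - ‖v 0‖ ^ 2| ≤ C * ‖g‖ ^ 2) ∧
    -- extension of the observability inequality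
    ((∃ τ ∈ Set.Icc 0 T, ∃ C₁ : ℝ, 0 < C₁ ∧ Transport.ObservabilityOn Ω T H τ C₁) →
      ∃ C₂ : ℝ, 0 < C₂ ∧ Transport.ObservabilityOn Ω T H T C₂) := by
  have hslice : ∀ (g : Lp ℝ 2 (Transport.lateralMeasure Ω T))
      (u : EuclideanSpace ℝ (Fin d) × ℝ → ℝ), Transport.IsSolution Ω T H g u →
        ∃ v : ℝ → Lp ℝ 2 (volume.restrict Ω), Transport.IsTimeSlice Ω T u v := by
    rintro g u ⟨ut, p, hu, -, φ, hφ, h0, h1, -, -⟩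
    obtain ⟨v, hv, -⟩ := Transport.exists_isTimeSlice hΩ.isOpen hΩ.isBounded hT hu.memLp
      hu.memLp_time hφ h0 h1
    exact ⟨v, hv⟩
  have henergy : ∃ C : ℝ, 0 < C ∧
      ∀ (g : Lp ℝ 2 (Transport.lateralMeasure Ω T)) (u : EuclideanSpace ℝ (Fin d) × ℝ → ℝ)
        (v : ℝ → Lp ℝ 2 (volume.restrict Ω)),
        Transport.IsSolution Ω T H g u → Transport.IsTimeSlice Ω T u v →
          ∀ t ∈ Set.Icc 0 T, |‖v t‖ ^ 2 - ‖v 0‖ ^ 2| ≤ C * ‖g‖ ^ 2 := by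
    obtain ⟨n, rfl⟩ : ∃ n, d = n + 1 := ⟨d - 1, by omega⟩
    obtain ⟨M, hM⟩ := isCompact_Icc.exists_bound_of_continuousOn hH
    -- `H` is frozen at its endpoint values outside `[0,T]`, which makes it globally continuous with
    -- the same bound.
    let H' : ℝ → EuclideanSpace ℝ (Fin (n + 1)) := fun s => H (projIcc 0 T hT.le s)
    have hH' : Continuous H' := hH.comp_continuous
      (continuous_subtype_val.comp continuous_projIcc) fun s => (projIcc 0 T hT.le s).2
    have hM' : ∀ s, ‖H' s‖ ≤ M := fun s => hM _ (projIcc 0 T hT.le s).2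
    have hM0 : 0 ≤ M := (norm_nonneg _).trans (hM' 0)
    -- The `+ 1` keeps the constant positive when `M = 0`.
    refine ⟨(n + 1) * (2 * M) + 1, by positivity, ?_⟩
    rintro g u v ⟨ut, p, hu, heq, φ, hφ, h0, h1, h2, h3⟩ hv t ht
    obtain ⟨w, hw, hlim⟩ := Transport.exists_isTimeSlice hΩ.isOpen hΩ.isBounded hT hu.memLp
      hu.memLp_time hφ h0 h1
    have hvw := hv.eqOn hT hw
    have heq' : ∀ᵐ z ∂(Transport.cylinderMeasure Ω T), ut z + inner ℝ (H' z.2) (p z) = 0 := by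
      have hmem : ∀ᵐ z ∂(Transport.cylinderMeasure Ω T), z ∈ Transport.cylinder Ω T :=
        ae_restrict_mem (hΩ.isOpen.measurableSet.prod measurableSet_Ioo)
      filter_upwards [heq, hmem] with z hz hzQ
      rwa [show H' z.2 = H z.2 by simp only [H', projIcc_of_mem hT.le (Ioo_subset_Icc_self hzQ.2)]]
    have key := Transport.enorm_norm_sq_sub_le hΩ.isOpen hΩ.isBounded hH' hM' hu.memLp hu.memLp_time
      hu.memLp_space heq' hφ h0 h1 h2 h3 hlim ht
    have hconst : ((n : ℝ≥0∞) + 1) * (2 * ENNReal.ofReal M) =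
        ENNReal.ofReal (((n : ℝ) + 1) * (2 * M)) := by
      rw [ENNReal.ofReal_mul (by positivity), ENNReal.ofReal_mul (by positivity),
        ENNReal.ofReal_add (by positivity) (by positivity)]
      simp
    rw [← hvw ht, ← hvw (left_mem_Icc.2 hT.le), Real.enorm_eq_ofReal_abs, ← ofReal_norm,
      ← ENNReal.ofReal_pow (norm_nonneg g), hconst, ← ENNReal.ofReal_mul (by positivity),
      ENNReal.ofReal_le_ofReal_iff (by positivity)] at key
    linarith [sq_nonneg ‖g‖]
  refine ⟨hslice, henergy, ?_⟩
  rintro ⟨τ, hτ, C₁, hC₁, hobs⟩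
  obtain ⟨C, hC, henergy⟩ := henergy
  -- From `‖v t‖² ≤ ‖v 0‖² + C‖g‖² ≤ (C₁² + C)‖g‖²`; the assumed inequality serves only at time `0`.
  refine ⟨Real.sqrt (C + C₁ ^ 2), by positivity, fun g u v hu hv t ht => ?_⟩
  have h0 := hobs g u v hu hv 0 (left_mem_Icc.2 hτ.1)
  have ht' := (abs_le.1 (henergy g u v hu hv t ht)).2
  have h0' : ‖v 0‖ ^ 2 ≤ (C₁ * ‖g‖) ^ 2 := pow_le_pow_left₀ (norm_nonneg _) h0 2
  refine le_of_sq_le_sq ?_ (by positivity)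
  rw [mul_pow, Real.sq_sqrt (by positivity)]
  linarith [mul_pow C₁ ‖g‖ 2]
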